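/- For real $s>0$ and $r>\tfrac12$ let $$y(s,r)=s+\mathop{\mathrm K}_{n=1}^{\infty}\left(\frac{(2n-1)^2r^2-(r-1)^2}{2s}\right) = s+\cfrac{r^2-(r-1)^2}{2s+\cfrac{9r^2-(r-1)^2}{2s+\cdots}}$$ be the generalized Brouncker continued fraction, and for real $r>\tfrac12$ and $D>0$ let $$T(r,D)=\cfrac{4\cdot 1^2r^2}{1+\cfrac{4\cdot1^2r^2}{D+\cfrac{4\cdot2^2r^2}{1+\cfrac{4\cdot2^2r^2}{D+\cdots}}}}$$ be the continued fraction whose partial numerators are $4n^2r^2,\,4n^2r^2$ $(n=1,2,\dots)$ and whose partial denominators are alternately $1$ and $D$. The value of a continued fraction is the limit of its convergents. Let $r>\tfrac12$ and $s>\max(1,2r-1)$. Then $y(s,r)$, $T(r,(1-2r+s)(1+s))$ and $T(r,(2r-1+s)(s-1))$ converge, $y(s,r)>0$, the function $\ln y(\cdot,r)$ is twice differentiable at $s$, the integral below converges absolutely, and $$\frac{\partial^2}{\partial s^2}(\ln y)(s,r)=-\frac1{2r^2}\int_0^\infty\frac{x\left(e^{-\frac{1-r+s}{r}x}+e^{-\frac{r-1+s}{r}x}\right)}{\cosh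 x}\,dx=-h_1(s,r)-h_2(s,r),$$ where the denominators of $$h_1(s,r)=\frac1{2(1-2r+s)(1+s)+2\,T\bigl(r,(1-2r+s)(1+s)\bigr)},\qquad h_2(s,r)=\frac1{2(2r-1+s)(s-1)+2\,T\bigl(r,(2r-1+s)(s-1)\bigr)}$$ are nonzero. -/

import Mathlib

open Filter Topology MeasureTheory

noncomputable section

namespace BrounckerCF

/-- The generalized continued fraction `h + K_{n ≥ 1} (a n / b n)`, i.e.
`h + a 1 / (b 1 + a 2 / (b 2 + ⋯))`. The values `a 0` and `b 0` are not used. -/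
def cf (h : ℝ) (a b : ℕ → ℝ) : GenContFract ℝ where
  h := h
  s := Stream'.Seq.ofStream
    (fun k : ℕ => (⟨a (k + 1), b (k + 1)⟩ : GenContFract.Pair ℝ))

/-- The two-step continued fraction `h + TK_{n ≥ 1} (a n / b n + c n / d n)`, i.e.
`h + a 1 / (b 1 + c 1 / (d 1 + a 2 / (b 2 + c 2 / (d 2 + ⋯))))`. -/
def tcf (h : ℝ) (a b c d : ℕ → ℝ) : GenContFract ℝ where
  h := h
  s := Stream'.Seq.ofStream
    (fun k : ℕ => if Even k
      then (⟨a (k / 2 + 1), b (k / 2 + 1)⟩ : GenContFract.Pair ℝ)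
      else (⟨c (k / 2 + 1), d (k / 2 + 1)⟩ : GenContFract.Pair ℝ))

/-- A continued fraction converges if at most finitely many of the denominators of its
convergents vanish and the convergents tend to a (finite) real number. -/
def Converges (g : GenContFract ℝ) : Prop :=
  (∀ᶠ n : ℕ in atTop, g.dens n ≠ 0) ∧ ∃ l : ℝ, Tendsto (fun n : ℕ => g.convs n) atTop (𝓝 l)

/-- The value of a continued fraction: the limit of its convergents
(meaningful when `Converges g`). -/
def value (g : GenContFract ℝ) : ℝ :=
  limUnder atTop (fun n : ℕ => g.convs n)

/-- `s + K_{n ≥ 1} (((2n-1)² r² - (r-1)²) / (2s))`. -/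
def yCF (s r : ℝ) : GenContFract ℝ :=
  cf s (fun n => (2 * (n : ℝ) - 1) ^ 2 * r ^ 2 - (r - 1) ^ 2) (fun _ => 2 * s)

/-- The generalized Brouncker continued fraction `y(s, r)`. -/
def y (s r : ℝ) : ℝ := value (yCF s r)

/-- `TK_{n ≥ 1} (4 n² r² / 1 + 4 n² r² / D)`. -/
def tailCF (r D : ℝ) : GenContFract ℝ :=
  tcf 0 (fun n => 4 * (n : ℝ) ^ 2 * r ^ 2) (fun _ => 1)
    (fun n => 4 * (n : ℝ) ^ 2 * r ^ 2) (fun _ => D)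

/-- The denominator in the definition of `h₁`. -/
def h₁den (s r : ℝ) : ℝ :=
  2 * (1 - 2 * r + s) * (1 + s) + 2 * value (tailCF r ((1 - 2 * r + s) * (1 + s)))

/-- The denominator in the definition of `h₂`. -/
def h₂den (s r : ℝ) : ℝ :=
  2 * (2 * r - 1 + s) * (s - 1) + 2 * value (tailCF r ((2 * r - 1 + s) * (s - 1)))

/-- The continued fraction `h₁(s, r)`. -/
def h₁ (s r : ℝ) : ℝ := 1 / h₁den s r

/-- The continued fraction `h₂(s, r)`. -/
def h₂ (s r : ℝ) : ℝ := 1 / h₂den s r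

/-- The integrand `x (e^{-x(1-r+s)/r} + e^{-x(r-1+s)/r}) / cosh x`. -/
def integrand (s r x : ℝ) : ℝ :=
  x * (Real.exp (-((1 - r + s) / r) * x) + Real.exp (-((r - 1 + s) / r) * x)) / Real.cosh x

end BrounckerCF

end

/-! Everything is reduced to functional equations under a shift by `2 * r`, and a decaying solution
of `δ t + δ (t + c) = 0` vanishes (`eq_zero_of_add_shift_eq_zero`).

For continued fractions with positive elements and at most quadratic growth, a sequence of positive
tails exists, its head is unique, and the convergents tend to `h + f 0` for such a sequence `f`
(`value_cf`). To evaluate a continued fraction it thus suffices to exhibit positive tails. A linear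
fractional substitution turns tails at the shifted parameter into tails at the original one. This
gives `y s * y (s + 2r) = (s + 1) (s + 2r - 1)` (`y_mul_y`) and, for `S t = D + T(r, D)` with `D =
t² - r²`, the relation `1 / S t + 1 / S (t + 2r) = 2 / (t + r)²` (`inv_shiftedTail_add`).

The Laplace transforms of `uⁿ / cosh u` satisfy an equation of the second kind, because `e^u +
e^{-u} = 2 cosh u`. Comparing decay at infinity, `1 / S t` is the transform with `n = 1` at `t / r`,
divided by `r²` (`inv_shiftedTail_eq`). Likewise `log y` is a sum of two antiderivatives of half the
transform with `n = 0`, up to scaling and a constant (`log_y_eq`). Its second derivative is then a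
sum of two transforms with `n = 1`, which are the integral and also, through `1 / S`, the terms `h₁`
and `h₂`. -/

noncomputable section

namespace BrounckerCF

/-! ### Continued fractions with positive elements -/

/-- `f` is a sequence of positive tails of `K (a n / b n)`. -/
def IsPosTail (a b f : ℕ → ℝ) : Prop :=
  ∀ n, 0 < f n ∧ f n * (b (n + 1) + f (n + 1)) = a (n + 1)

/-- Positive elements, with `a (n + 1) / (b n * b (n + 1))` growing at most quadratically. -/
structure SlowGrowth (a b : ℕ → ℝ) : Prop where
  a_pos : ∀ n, 0 < a (n + 1)
  b_pos : ∀ n, 0 < b (n + 1)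
  growth : ∃ C > 0, ∀ n : ℕ, a (n + 2) ≤ (C * (n + 1)) ^ 2 * (b (n + 1) * b (n + 2))

/-- The ratios of consecutive solutions of the three-term recurrence of `K (a n / b n)`. -/
def forward (a b : ℕ → ℝ) : ℕ → ℝ
  -- Any positive initial value would serve.
  | 0 => 1
  | n + 1 => b (n + 1) + a (n + 1) / forward a b n

theorem forward_pos {a b : ℕ → ℝ} (h : SlowGrowth a b) (n : ℕ) : 0 < forward a b n := by
  induction n with
  | zero => exact one_pos
  | succ n ih => exact add_pos (h.b_pos n) (div_pos (h.a_pos n) ih)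

theorem forward_mul {a b : ℕ → ℝ} (h : SlowGrowth a b) (n : ℕ) :
    forward a b n * forward a b (n + 1) = a (n + 1) + b (n + 1) * forward a b n := by
  have := (forward_pos h n).ne'
  rw [forward]
  field_simp
  ring

/-- The distance of two tails, normalized by `forward`. -/
def tailGap (a b u v : ℕ → ℝ) (n : ℕ) : ℝ :=
  |u n - v n| * forward a b n / ((u n + forward a b n) * (v n + forward a b n))

theorem tailGap_nonneg {a b u v : ℕ → ℝ} (h : SlowGrowth a b) (hu : IsPosTail a b u)
    (hv : IsPosTail a b v) (n : ℕ) : 0 ≤ tailGap a b u v n := by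
  have h1 := forward_pos h n
  have h2 := (hu n).1
  have h3 := (hv n).1
  unfold tailGap
  positivity

theorem tailGap_le_one {a b u v : ℕ → ℝ} (h : SlowGrowth a b) (hu : IsPosTail a b u)
    (hv : IsPosTail a b v) (n : ℕ) : tailGap a b u v n ≤ 1 := by
  have h1 := forward_pos h n
  have h2 := (hu n).1
  have h3 := (hv n).1
  unfold tailGap
  rw [div_le_one (by positivity)]
  have : |u n - v n| ≤ u n + v n := abs_le.2 ⟨by linarith, by linarith⟩
  nlinarith [mul_le_mul_of_nonneg_right this h1.le, mul_pos h2 h3]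

/-- With `w = forward a b`, the identity `w n * w (n + 1) = a (n + 1) + b (n + 1) * w n` gives `u n
+ w n = w n * (u (n + 1) + w (n + 1)) / (b (n + 1) + u (n + 1))`, and the same for `v`. All
dependence on `u` and `v` cancels from the quotient of consecutive gaps. -/
theorem tailGap_succ {a b u v : ℕ → ℝ} (h : SlowGrowth a b) (hu : IsPosTail a b u)
    (hv : IsPosTail a b v) (n : ℕ) :
    tailGap a b u v (n + 1)
      = (1 + b (n + 1) * forward a b n / a (n + 1)) * tailGap a b u v n := by
  have hw := forward_pos h n
  have hw' := forward_pos h (n + 1)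
  have hu1 := (hu (n + 1)).1
  have hv1 := (hv (n + 1)).1
  have hb := h.b_pos n
  have ha := h.a_pos n
  have hU : u n = a (n + 1) / (b (n + 1) + u (n + 1)) := by
    rw [eq_div_iff (by positivity)]; exact (hu n).2
  have hV : v n = a (n + 1) / (b (n + 1) + v (n + 1)) := by
    rw [eq_div_iff (by positivity)]; exact (hv n).2
  have hF : forward a b (n + 1) = b (n + 1) + a (n + 1) / forward a b n := rfl
  have hd : u n - v n = -(a (n + 1) / ((b (n + 1) + u (n + 1)) * (b (n + 1) + v (n + 1))))
      * (u (n + 1) - v (n + 1)) := by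
    rw [hU, hV]; field_simp; ring
  have hq : 0 < a (n + 1) / ((b (n + 1) + u (n + 1)) * (b (n + 1) + v (n + 1))) := by positivity
  unfold tailGap
  rw [hd, abs_mul, abs_neg, abs_of_pos hq, hU, hV, hF]
  clear hd hq hU hV hF hw'
  generalize forward a b n = w at *
  generalize |u (n + 1) - v (n + 1)| = d
  field_simp
  ring

/-- A single growth factor `1 + e` may be close to `1`, but the product of two consecutive
increments is at least `1 / (C (n + 1))²`, so by the arithmetic-geometric mean inequality their sum
is at least `2 / (C (n + 1))`. -/
theorem one_add_le_factor {a b : ℕ → ℝ} (h : SlowGrowth a b) {C : ℝ} (hC : 0 < C) (n : ℕ)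
    (hg : a (n + 2) ≤ (C * (n + 1)) ^ 2 * (b (n + 1) * b (n + 2))) :
    1 + 2 / C * (1 / ((n : ℝ) + 1)) ≤ (1 + b (n + 2) * forward a b (n + 1) / a (n + 2))
      * (1 + b (n + 1) * forward a b n / a (n + 1)) := by
  have hw := forward_pos h n
  have hw' := forward_pos h (n + 1)
  have hb := h.b_pos n
  have ha := h.a_pos n
  have hb' := h.b_pos (n + 1)
  have ha' := h.a_pos (n + 1)
  have hm := forward_mul h n
  set e := b (n + 1) * forward a b n / a (n + 1) with he
  set e' := b (n + 2) * forward a b (n + 1) / a (n + 2) with he'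
  have hepos : 0 < e := by positivity
  have hepos' : 0 < e' := by positivity
  set k : ℝ := C * (n + 1) with hk
  have hkpos : 0 < k := by positivity
  have hkk : 2 / C * (1 / ((n : ℝ) + 1)) = 2 / k := by rw [hk]; field_simp
  have hee : 1 / k ^ 2 ≤ e * e' := by
    have : e * e' = b (n + 1) * b (n + 2) / a (n + 2)
        * ((a (n + 1) + b (n + 1) * forward a b n) / a (n + 1)) := by
      rw [← hm, he, he']; field_simp
    rw [this]
    have h1 : 1 ≤ (a (n + 1) + b (n + 1) * forward a b n) / a (n + 1) := by
      rw [one_le_div ha]; nlinarith [mul_pos hb hw]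
    have h2 : 1 / k ^ 2 ≤ b (n + 1) * b (n + 2) / a (n + 2) := by
      rw [div_le_div_iff₀ (by positivity) ha']; linarith
    calc 1 / k ^ 2 ≤ b (n + 1) * b (n + 2) / a (n + 2) * 1 := by rwa [mul_one]
      _ ≤ _ := mul_le_mul_of_nonneg_left h1 (by positivity)
  have hsum : 2 / k ≤ e + e' := by
    refine le_of_sq_le_sq ?_ (by positivity)
    have : (2 / k) ^ 2 = 4 * (1 / k ^ 2) := by field_simp; norm_num
    nlinarith [sq_nonneg (e - e')]
  rw [hkk]
  nlinarith [mul_pos hepos hepos']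

/-- The gap never exceeds `1`, yet it is multiplied by factors whose product diverges with the
harmonic series, so the initial gap must be zero. -/
theorem IsPosTail.head_unique {a b u v : ℕ → ℝ} (h : SlowGrowth a b) (hu : IsPosTail a b u)
    (hv : IsPosTail a b v) : u 0 = v 0 := by
  obtain ⟨C, hC, hg⟩ := h.growth
  have key : ∀ N : ℕ, tailGap a b u v 0
      * (1 + 1 / C * ∑ i ∈ Finset.range N, 1 / ((i : ℝ) + 1)) ≤ tailGap a b u v (2 * N) := by
    intro N
    induction N with
    | zero => simp
    | succ N ih =>
      have hstep := one_add_le_factor h hC (2 * N) (hg (2 * N))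
      have e1 : tailGap a b u v (2 * (N + 1)) = _ := tailGap_succ h hu hv (2 * N + 1)
      rw [tailGap_succ h hu hv (2 * N), ← mul_assoc] at e1
      rw [e1, Finset.sum_range_succ]
      set S := ∑ i ∈ Finset.range N, 1 / ((i : ℝ) + 1)
      have hS : 0 ≤ S := Finset.sum_nonneg fun i _ => by positivity
      have h0 := tailGap_nonneg h hu hv 0
      have hN := tailGap_nonneg h hu hv (2 * N)
      have hcmp : 1 / C * (1 / ((N : ℝ) + 1)) ≤ 2 / C * (1 / (((2 * N : ℕ) : ℝ) + 1)) := by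
        rw [div_mul_div_comm, div_mul_div_comm, div_le_div_iff₀ (by positivity) (by positivity)]
        push_cast
        nlinarith
      have hδ : 0 ≤ 1 / C * (1 / ((N : ℝ) + 1)) := by positivity
      have hCS : 0 ≤ 1 / C * S := by positivity
      calc tailGap a b u v 0 * (1 + 1 / C * (S + 1 / ((N : ℝ) + 1)))
          ≤ (1 + 1 / C * (1 / ((N : ℝ) + 1))) * (tailGap a b u v 0 * (1 + 1 / C * S)) := by
            nlinarith [mul_nonneg h0 (mul_nonneg hδ hCS)]
        _ ≤ (1 + 1 / C * (1 / ((N : ℝ) + 1))) * tailGap a b u v (2 * N) :=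
            mul_le_mul_of_nonneg_left ih (by positivity)
        _ ≤ _ := mul_le_mul_of_nonneg_right (le_trans (by linarith) hstep) hN
  have hgap : tailGap a b u v 0 = 0 := by
    by_contra hne
    have hpos : 0 < tailGap a b u v 0 := lt_of_le_of_ne (tailGap_nonneg h hu hv 0) (Ne.symm hne)
    obtain ⟨N, hN⟩ := (Real.tendsto_sum_range_one_div_nat_succ_atTop.eventually_ge_atTop
      (C / tailGap a b u v 0)).exists
    have h1 := (key N).trans (tailGap_le_one h hu hv _)
    have h2 : 1 / tailGap a b u v 0
        ≤ 1 / C * ∑ i ∈ Finset.range N, 1 / ((i : ℝ) + 1) := by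
      calc 1 / tailGap a b u v 0 = 1 / C * (C / tailGap a b u v 0) := by field_simp
        _ ≤ _ := mul_le_mul_of_nonneg_left hN (by positivity)
    have h3 := mul_le_mul_of_nonneg_left h2 hpos.le
    rw [mul_one_div_cancel hpos.ne'] at h3
    nlinarith
  have h1 := forward_pos h 0
  have h2 := (hu 0).1
  have h3 := (hv 0).1
  unfold tailGap at hgap
  rw [div_eq_zero_iff, mul_eq_zero] at hgap
  rcases hgap with (h4 | h4) | h4
  · linarith [abs_eq_zero.1 h4]
  · exact absurd h4 h1.ne'
  · exact absurd h4 (by positivity)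

/-! ### Convergence of the convergents to the head of the positive tails -/

/-- The value of `a (n + 1) / (b (n + 1) + ⋯ + a (n + N) / b (n + N))`. -/
def backward (a b : ℕ → ℝ) : ℕ → ℕ → ℝ
  | _, 0 => 0
  | n, N + 1 => a (n + 1) / (b (n + 1) + backward a b (n + 1) N)

theorem backward_mem {a b : ℕ → ℝ} (h : SlowGrowth a b) (n N : ℕ) :
    backward a b n N ∈ Set.Icc 0 (a (n + 1) / b (n + 1)) := by
  induction N generalizing n with
  | zero => exact ⟨le_rfl, (div_pos (h.a_pos n) (h.b_pos n)).le⟩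
  | succ N ih =>
    have h1 := (ih (n + 1)).1
    have hb := h.b_pos n
    have ha := h.a_pos n
    rw [backward]
    exact ⟨by positivity, div_le_div_of_nonneg_left ha.le hb (by linarith)⟩

theorem exists_isPosTail_tendsto {a b : ℕ → ℝ} (h : SlowGrowth a b) (U : Ultrafilter ℕ)
    (hU : (U : Filter ℕ) ≤ atTop) :
    ∃ f, IsPosTail a b f ∧ Tendsto (fun N => backward a b 0 N) U (𝓝 (f 0)) := by
  -- The length `N - n` makes the truncations at all levels end at the same index `N`, so that one
  -- ultrafilter gives limits satisfying the tail recurrence. The truncated subtraction matters only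
  -- for `N < n`.
  have hex : ∀ n, ∃ x ∈ Set.Icc 0 (a (n + 1) / b (n + 1)),
      Tendsto (fun N => backward a b n (N - n)) U (𝓝 x) := fun n =>
    isCompact_Icc.ultrafilter_le_nhds' (U.map fun N : ℕ => backward a b n (N - n))
      (Filter.mem_map.2 (Filter.univ_mem' fun N : ℕ => backward_mem h n (N - n)))
  choose f hf hlim using hex
  have hrec : ∀ n, f n = a (n + 1) / (b (n + 1) + f (n + 1)) := by
    intro n
    have hb := h.b_pos n
    have h1 := (hf (n + 1)).1
    refine tendsto_nhds_unique (hlim n) ?_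
    refine (tendsto_const_nhds.div (tendsto_const_nhds.add (hlim (n + 1)))
      (by positivity)).congr' ?_
    filter_upwards [hU (eventually_ge_atTop (n + 1))] with N hN
    obtain ⟨k, rfl⟩ := Nat.exists_eq_add_of_le hN
    change a (n + 1) / (b (n + 1) + backward a b (n + 1) (n + 1 + k - (n + 1))) = _
    rw [show n + 1 + k - (n + 1) = k by omega, show n + 1 + k - n = k + 1 by omega, backward]
  refine ⟨f, fun n => ?_, hlim 0⟩
  have hb := h.b_pos n
  have ha := h.a_pos n
  have h1 := (hf (n + 1)).1
  refine ⟨by rw [hrec n]; positivity, ?_⟩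
  rw [hrec n]
  field_simp

theorem exists_isPosTail {a b : ℕ → ℝ} (h : SlowGrowth a b) : ∃ f, IsPosTail a b f :=
  let ⟨f, hf, _⟩ := exists_isPosTail_tendsto h (Ultrafilter.of atTop) (Ultrafilter.of_le atTop)
  ⟨f, hf⟩

/-- Along every ultrafilter the limit is the head of some positive tail sequence, and that head is
unique. -/
theorem tendsto_backward {a b f : ℕ → ℝ} (h : SlowGrowth a b) (hf : IsPosTail a b f) :
    Tendsto (fun N => backward a b 0 N) atTop (𝓝 (f 0)) := by
  rw [tendsto_iff_ultrafilter]
  intro U hU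
  obtain ⟨g, hg, hlim⟩ := exists_isPosTail_tendsto h U hU
  rwa [hf.head_unique h hg]

theorem convs'Aux_ofStream (a b : ℕ → ℝ) (n N : ℕ) :
    GenContFract.convs'Aux (Stream'.Seq.ofStream
      (fun k : ℕ => (⟨a (n + k + 1), b (n + k + 1)⟩ : GenContFract.Pair ℝ))) N
      = backward a b n N := by
  induction N generalizing n with
  | zero => rfl
  | succ N ih =>
    rw [GenContFract.convs'Aux_succ_some (p := ⟨a (n + 1), b (n + 1)⟩) rfl, backward, ← ih]
    congr 3
    apply Subtype.ext
    funext k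
    change some (⟨a (n + (k + 1) + 1), b (n + (k + 1) + 1)⟩ : GenContFract.Pair ℝ)
      = some ⟨a (n + 1 + k + 1), b (n + 1 + k + 1)⟩
    rw [show n + (k + 1) + 1 = n + 1 + k + 1 by ring]

theorem cf_get? (c : ℝ) (a b : ℕ → ℝ) (k : ℕ) :
    (cf c a b).s.get? k = some ⟨a (k + 1), b (k + 1)⟩ := rfl

theorem cf_convs {a b : ℕ → ℝ} (h : SlowGrowth a b) (c : ℝ) (N : ℕ) :
    (cf c a b).convs N = c + backward a b 0 N := by
  rw [GenContFract.convs_eq_convs']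
  · rw [← convs'Aux_ofStream]
    simp only [zero_add]
    rfl
  · intro gp m _ hgp
    rw [cf_get?, Option.some_inj] at hgp
    subst hgp
    exact ⟨h.a_pos m, h.b_pos m⟩

theorem cf_dens_pos {a b : ℕ → ℝ} (h : SlowGrowth a b) (c : ℝ) (n : ℕ) :
    0 < (cf c a b).dens n := by
  induction n using Nat.twoStepInduction with
  | zero => simp [GenContFract.zeroth_den_eq_one]
  | one => rw [GenContFract.first_den_eq (cf_get? c a b 0)]; exact h.b_pos 0
  | more n h1 h2 =>
    rw [GenContFract.dens_recurrence (cf_get? c a b (n + 1)) rfl rfl]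
    exact add_pos (mul_pos (h.b_pos _) h2) (mul_pos (h.a_pos _) h1)

theorem cf_tendsto {a b f : ℕ → ℝ} (h : SlowGrowth a b) (hf : IsPosTail a b f) (c : ℝ) :
    Tendsto (fun n => (cf c a b).convs n) atTop (𝓝 (c + f 0)) := by
  simp only [cf_convs h]
  exact tendsto_const_nhds.add (tendsto_backward h hf)

theorem converges_cf {a b : ℕ → ℝ} (h : SlowGrowth a b) (c : ℝ) : Converges (cf c a b) :=
  let ⟨_, hf⟩ := exists_isPosTail h
  ⟨Eventually.of_forall fun n => (cf_dens_pos h c n).ne', _, cf_tendsto h hf c⟩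

theorem value_cf {a b f : ℕ → ℝ} (h : SlowGrowth a b) (hf : IsPosTail a b f) (c : ℝ) :
    value (cf c a b) = c + f 0 :=
  (cf_tendsto h hf c).limUnder_eq

/-! ### The functional equation of the generalized Brouncker continued fraction -/

theorem yCF_num_lower (r : ℝ) (n : ℕ) :
    r ^ 2 - (r - 1) ^ 2 ≤ (2 * ((n + 1 : ℕ) : ℝ) - 1) ^ 2 * r ^ 2 - (r - 1) ^ 2 := by
  have hn : (0 : ℝ) ≤ n := n.cast_nonneg
  push_cast
  have : (1 : ℝ) ≤ (2 * ((n : ℝ) + 1) - 1) ^ 2 := by nlinarith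
  nlinarith [mul_le_mul_of_nonneg_right this (sq_nonneg r)]

theorem slowGrowth_yCF {s r : ℝ} (hr : 1 / 2 < r) (hs : 0 < s) :
    SlowGrowth (fun n => (2 * (n : ℝ) - 1) ^ 2 * r ^ 2 - (r - 1) ^ 2) (fun _ => 2 * s) where
  a_pos n := lt_of_lt_of_le (by nlinarith) (yCF_num_lower r n)
  b_pos _ := by positivity
  growth := by
    -- The factor `3` comes from `2 (n + 2) - 1 ≤ 3 (n + 1)`.
    refine ⟨3 * r / (2 * s), by have : 0 < r := by linarith
                                positivity, fun n => ?_⟩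
    have hn : (0 : ℝ) ≤ n := n.cast_nonneg
    have e : (3 * r / (2 * s) * ((n : ℝ) + 1)) ^ 2 * (2 * s * (2 * s))
        = (3 * ((n : ℝ) + 1)) ^ 2 * r ^ 2 := by field_simp
    rw [e]
    push_cast
    have : (2 * ((n : ℝ) + 2) - 1) ^ 2 ≤ (3 * ((n : ℝ) + 1)) ^ 2 := by nlinarith
    nlinarith [mul_le_mul_of_nonneg_right this (sq_nonneg r), sq_nonneg (r - 1)]

theorem converges_yCF {s r : ℝ} (hr : 1 / 2 < r) (hs : 0 < s) : Converges (yCF s r) :=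
  converges_cf (slowGrowth_yCF hr hs) s

theorem y_lower {s r : ℝ} (hr : 1 / 2 < r) (hs : 0 < s) : s < y s r := by
  obtain ⟨f, hf⟩ := exists_isPosTail (slowGrowth_yCF hr hs)
  rw [y, yCF, value_cf (slowGrowth_yCF hr hs) hf]
  linarith [(hf 0).1]

theorem y_upper {s r : ℝ} (hr : 1 / 2 < r) (hs : 0 < s) :
    y s r ≤ s + (r ^ 2 - (r - 1) ^ 2) / (2 * s) := by
  obtain ⟨f, hf⟩ := exists_isPosTail (slowGrowth_yCF hr hs)
  rw [y, yCF, value_cf (slowGrowth_yCF hr hs) hf]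
  have h0 := (hf 0).1
  have h1 := (hf 1).1
  have h2 := (hf 0).2
  simp only [zero_add] at h2
  rw [add_le_add_iff_left, le_div_iff₀ (by positivity)]
  push_cast at h2
  nlinarith [mul_pos h0 h1]

/-- Tails `f n` at `s + 2r` and `k n - 2s` at `s` are linked by `(k n - s - 2nr) * (f n + s + 2(n +
1)r) = Q`. Under this substitution one tail recurrence becomes the other, and at `n = 0` the two
factors are the two values of `y`. -/
theorem y_mul_y {s r : ℝ} (hr : 1 / 2 < r) (hs : 0 < s) :
    y s r * y (s + 2 * r) r = (s + r) ^ 2 - (r - 1) ^ 2 := by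
  have hs' : 0 < s + 2 * r := by linarith
  obtain ⟨f, hf⟩ := exists_isPosTail (slowGrowth_yCF hr hs')
  set E : ℕ → ℝ := fun n => 2 * (s + 2 * r) + f n + (2 * n - 1) * r - (s + r) with hE
  have hEpos : ∀ n, 0 < E n := fun n => by
    have := (hf n).1
    have hn : (0 : ℝ) ≤ n := n.cast_nonneg
    simp only [hE]
    nlinarith
  set Q : ℝ := (s + r) ^ 2 - (r - 1) ^ 2 with hQ
  have hQpos : 0 < Q := by nlinarith
  set k : ℕ → ℝ := fun n => s + 2 * n * r + Q / E n with hk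
  have hkpos : ∀ n, 0 < k n := fun n => by
    have := hEpos n
    have hr0 : 0 < r := by linarith
    simp only [hk]
    positivity
  have hrec : ∀ n : ℕ, (k n - 2 * s) * k (n + 1)
      = (2 * ((n + 1 : ℕ) : ℝ) - 1) ^ 2 * r ^ 2 - (r - 1) ^ 2 := by
    intro n
    have h1 := (hEpos n).ne'
    have h2 := (hEpos (n + 1)).ne'
    have h3 := (hf n).2
    have e1 : f n = E n - (2 * (s + 2 * r) + (2 * n - 1) * r - (s + r)) := by
      simp only [hE]; ring
    have e2 : f (n + 1) = E (n + 1) - (2 * (s + 2 * r) + (2 * n + 1) * r - (s + r)) := by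
      simp only [hE]; push_cast; ring
    rw [e1, e2] at h3
    simp only [hk]
    push_cast at h3 ⊢
    generalize E n = x at *
    generalize E (n + 1) = z at *
    field_simp
    rw [hQ]
    linear_combination (-((s + r) ^ 2 - (r - 1) ^ 2)) * h3
  have htail : IsPosTail (fun n => (2 * (n : ℝ) - 1) ^ 2 * r ^ 2 - (r - 1) ^ 2)
      (fun _ => 2 * s) (fun n => k n - 2 * s) := fun n => by
    refine ⟨?_, by rw [add_sub_cancel]; exact hrec n⟩
    -- Positivity of `k n - 2 * s` is read off the recurrence: both the product and `k (n + 1)` are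
    -- positive.
    have := (slowGrowth_yCF hr hs).a_pos n
    rw [← hrec n] at this
    exact pos_of_mul_pos_left this (hkpos _).le
  rw [y, y, yCF, yCF, value_cf (slowGrowth_yCF hr hs) htail,
    value_cf (slowGrowth_yCF hr hs') hf]
  have h0 := (hEpos 0).ne'
  have e0 : f 0 = E 0 - (2 * (s + 2 * r) - r - (s + r)) := by simp only [hE]; push_cast; ring
  rw [e0]
  simp only [hk]
  push_cast
  generalize E 0 = x at *
  field_simp
  ring

/-! ### The functional equation of the two-step continued fraction -/

/-- The partial numerators of `tailCF r D`. -/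
def tailNum (r : ℝ) (n : ℕ) : ℝ := 4 * (((n - 1) / 2 + 1 : ℕ) : ℝ) ^ 2 * r ^ 2

/-- The partial denominators of `tailCF r D`. -/
def tailDen (D : ℝ) (n : ℕ) : ℝ := if Even (n - 1) then 1 else D

theorem tailCF_eq_cf (r D : ℝ) : tailCF r D = cf 0 (tailNum r) (tailDen D) := by
  unfold tailCF tcf cf
  congr 2
  funext k
  simp only [tailNum, tailDen, Nat.add_sub_cancel]
  split_ifs <;> rfl

theorem tailNum_odd (r : ℝ) (n : ℕ) : tailNum r (2 * n + 1) = 4 * ((n : ℝ) + 1) ^ 2 * r ^ 2 := by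
  rw [tailNum, show (2 * n + 1 - 1) / 2 + 1 = n + 1 by omega]
  push_cast
  ring

theorem tailNum_even (r : ℝ) (n : ℕ) : tailNum r (2 * n + 2) = 4 * ((n : ℝ) + 1) ^ 2 * r ^ 2 := by
  rw [tailNum, show (2 * n + 2 - 1) / 2 + 1 = n + 1 by omega]
  push_cast
  ring

theorem tailDen_odd (D : ℝ) (n : ℕ) : tailDen D (2 * n + 1) = 1 := by
  simp [tailDen]

theorem tailDen_even (D : ℝ) (n : ℕ) : tailDen D (2 * n + 2) = D := by
  rw [tailDen, if_neg]
  rw [show 2 * n + 2 - 1 = 2 * n + 1 by omega]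
  simp

theorem slowGrowth_tailCF {r D : ℝ} (hr : 0 < r) (hD : 0 < D) :
    SlowGrowth (tailNum r) (tailDen D) where
  a_pos n := by unfold tailNum; positivity
  b_pos n := by unfold tailDen; split_ifs <;> positivity
  growth := by
    have hsq : 0 < √D := Real.sqrt_pos.2 hD
    -- Denominators alternate between `1` and `D`, so the product of two neighbours is always `D`.
    refine ⟨3 * r / √D, by positivity, fun n => ?_⟩
    have hb : tailDen D (n + 1) * tailDen D (n + 2) = D := by
      obtain ⟨m, rfl | rfl⟩ := n.even_or_odd'
      · rw [tailDen_odd, tailDen_even, one_mul]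
      · rw [show 2 * m + 1 + 1 = 2 * m + 2 by ring, show 2 * m + 1 + 2 = 2 * (m + 1) + 1 by ring,
          tailDen_odd, tailDen_even, mul_one]
    have e : (3 * r / √D * ((n : ℝ) + 1)) ^ 2 * D = (3 * ((n : ℝ) + 1)) ^ 2 * r ^ 2 := by
      rw [mul_pow, div_pow, Real.sq_sqrt hD.le]
      field_simp
    rw [hb, e, tailNum]
    refine mul_le_mul_of_nonneg_right ?_ (sq_nonneg r)
    have h2 : 2 * ((n + 2 - 1) / 2 + 1) ≤ 3 * (n + 1) := by omega
    have h3 : (2 : ℝ) * (((n + 2 - 1) / 2 + 1 : ℕ) : ℝ) ≤ 3 * ((n : ℝ) + 1) := by exact_mod_cast h2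
    calc 4 * (((n + 2 - 1) / 2 + 1 : ℕ) : ℝ) ^ 2
        = (2 * (((n + 2 - 1) / 2 + 1 : ℕ) : ℝ)) ^ 2 := by ring
      _ ≤ _ := pow_le_pow_left₀ (by positivity) h3 2

theorem converges_tailCF {r D : ℝ} (hr : 0 < r) (hD : 0 < D) : Converges (tailCF r D) := by
  rw [tailCF_eq_cf]
  exact converges_cf (slowGrowth_tailCF hr hD) 0

theorem value_tailCF_pos {r D : ℝ} (hr : 0 < r) (hD : 0 < D) : 0 < value (tailCF r D) := by
  obtain ⟨f, hf⟩ := exists_isPosTail (slowGrowth_tailCF hr hD)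
  rw [tailCF_eq_cf, value_cf (slowGrowth_tailCF hr hD) hf, zero_add]
  exact (hf 0).1

/-- `D + T(r, D)` for `D = t² - r²`. -/
def shiftedTail (r t : ℝ) : ℝ := t ^ 2 - r ^ 2 + value (tailCF r (t ^ 2 - r ^ 2))

/-- A two-step recurrence with positive terms determines the value of `tailCF`. -/
theorem value_tailCF_of_rec {r D : ℝ} (hr : 0 < r) (hD : 0 < D) {k : ℕ → ℝ} (hk : ∀ n, 0 < k n)
    (hrec : ∀ n : ℕ, (k n - D) * (1 + 4 * ((n : ℝ) + 1) ^ 2 * r ^ 2 / k (n + 1))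
      = 4 * ((n : ℝ) + 1) ^ 2 * r ^ 2) :
    D + value (tailCF r D) = k 0 := by
  have htail : IsPosTail (tailNum r) (tailDen D) (fun n => if Even n then k (n / 2) - D
      else 4 * ((n / 2 : ℕ) + 1 : ℝ) ^ 2 * r ^ 2 / k (n / 2 + 1)) := by
    intro n
    obtain ⟨m, rfl | rfl⟩ := n.even_or_odd'
    · have h1 := hk (m + 1)
      have h2 : 0 < (k m - D) * (1 + 4 * ((m : ℝ) + 1) ^ 2 * r ^ 2 / k (m + 1)) := by
        rw [hrec]; positivity
      have e1 : (2 * m + 1) / 2 = m := by omega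
      have e2 : 2 * m / 2 = m := by omega
      have h3 : ¬ Even (2 * m + 1) := by simp
      have h4 : Even (2 * m) := by simp
      simp only [h4, h3, if_true, if_false, e1, e2, tailNum_odd, tailDen_odd, hrec, and_true]
      exact pos_of_mul_pos_left h2 (by positivity)
    · have h1 := hk (m + 1)
      have e1 : (2 * m + 1) / 2 = m := by omega
      have e2 : (2 * m + 1 + 1) / 2 = m + 1 := by omega
      have h3 : ¬ Even (2 * m + 1) := by simp
      have h4 : Even (2 * m + 1 + 1) := ⟨m + 1, by ring⟩
      simp only [h4, h3, if_true, if_false, e1, e2, tailNum_even, tailDen_even]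
      refine ⟨by positivity, ?_⟩
      rw [add_sub_cancel, div_mul_cancel₀ _ h1.ne']
  rw [tailCF_eq_cf, value_cf (slowGrowth_tailCF hr hD) htail]
  simp

/-- With `q = t + r`, the even tails `w n` at `t + 2r` and `k n` at `t`, each with its `D` added,
are linked by `(2 k n - q (q + 4nr)) * (2 w n - q (q - 4nr)) = q⁴`. At `n = 0` this is equivalent to
`1 / k 0 + 1 / w 0 = 2 / q²`. -/
theorem inv_shiftedTail_add {r t : ℝ} (hr : 0 < r) (ht : r < t) :
    1 / shiftedTail r t + 1 / shiftedTail r (t + 2 * r) = 2 / (t + r) ^ 2 := by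
  have hD : 0 < t ^ 2 - r ^ 2 := by nlinarith
  have hD' : 0 < (t + 2 * r) ^ 2 - r ^ 2 := by nlinarith
  obtain ⟨f, hf⟩ := exists_isPosTail (slowGrowth_tailCF hr hD')
  set D' := (t + 2 * r) ^ 2 - r ^ 2 with hD'_def
  set q := t + r with hq
  have hq0 : 0 < q := by linarith
  set w : ℕ → ℝ := fun n => D' + f (2 * n) with hw
  have hwpos : ∀ n, D' < w n := fun n => by linarith [(hf (2 * n)).1]
  have hwrec : ∀ n : ℕ, (w n - D') * (1 + 4 * ((n : ℝ) + 1) ^ 2 * r ^ 2 / w (n + 1))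
      = 4 * ((n : ℝ) + 1) ^ 2 * r ^ 2 := by
    intro n
    have h1 := (hf (2 * n)).2
    have h2 := (hf (2 * n + 1)).2
    rw [tailNum_odd, tailDen_odd] at h1
    rw [tailNum_even, tailDen_even] at h2
    have h3 : w (n + 1) = D' + f (2 * n + 1 + 1) := rfl
    rw [← h3] at h2
    have h4 : 0 < w (n + 1) := hD'.trans (hwpos _)
    rw [← h2, mul_div_cancel_right₀ _ h4.ne', h2, ← h1]
    simp only [hw]
    ring
  set E : ℕ → ℝ := fun n => 2 * w n - q * (q - 4 * n * r) with hE
  -- Here `D' = (q + r)² - r² = q² + 2qr`, so already `2 * D'` exceeds `q²`.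
  have hEpos : ∀ n, 0 < E n := fun n => by
    have h1 := hwpos n
    have h2 : 0 ≤ 4 * n * r * q := by positivity
    simp only [hE]
    nlinarith [mul_pos hr hq0]
  set k : ℕ → ℝ := fun n => (q * (q + 4 * n * r) + q ^ 4 / E n) / 2 with hk
  have hkpos : ∀ n, 0 < k n := fun n => by
    have := hEpos n
    simp only [hk]
    positivity
  have hkrec : ∀ n : ℕ, (k n - (t ^ 2 - r ^ 2)) * (1 + 4 * ((n : ℝ) + 1) ^ 2 * r ^ 2 / k (n + 1))
      = 4 * ((n : ℝ) + 1) ^ 2 * r ^ 2 := by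
    intro n
    have h1 := hEpos n
    have h2 := hEpos (n + 1)
    have h3 := hkpos (n + 1)
    have h4 := hwrec n
    have h5 : 0 < w (n + 1) := hD'.trans (hwpos _)
    have h6 : (w n - D') * (w (n + 1) + 4 * ((n : ℝ) + 1) ^ 2 * r ^ 2)
        = 4 * ((n : ℝ) + 1) ^ 2 * r ^ 2 * w (n + 1) := by
      rw [one_add_div h5.ne', ← mul_div_assoc, div_eq_iff h5.ne'] at h4
      exact h4
    suffices h7 : (k n - (t ^ 2 - r ^ 2)) * (k (n + 1) + 4 * ((n : ℝ) + 1) ^ 2 * r ^ 2)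
        = 4 * ((n : ℝ) + 1) ^ 2 * r ^ 2 * k (n + 1) by
      rw [one_add_div h3.ne', ← mul_div_assoc, h7, mul_div_cancel_right₀ _ h3.ne']
    have ew : w n = (E n + q * (q - 4 * n * r)) / 2 := by simp only [hE]; ring
    have ew' : w (n + 1) = (E (n + 1) + q * (q - 4 * (n + 1) * r)) / 2 := by
      simp only [hE]; push_cast; ring
    have et : t = q - r := by rw [hq]; ring
    rw [ew, ew', hD'_def, et] at h6
    rw [et]
    simp only [hk]
    push_cast
    clear_value q
    generalize E n = x at *
    generalize E (n + 1) = z at *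
    field_simp
    field_simp at h6
    linear_combination (-q ^ 4) * h6
  have hval := value_tailCF_of_rec hr hD hkpos hkrec
  have hval' := value_tailCF_of_rec hr hD' (fun n => hD'.trans (hwpos n)) hwrec
  have h0 := hEpos 0
  have h1 := hkpos 0
  have h2 := hD'.trans (hwpos 0)
  rw [shiftedTail, hval, shiftedTail, hval']
  have hrel : 2 * (k 0 * w 0) = q ^ 2 * (k 0 + w 0) := by
    have e : (2 * k 0 - q ^ 2) * E 0 = q ^ 4 := by
      simp only [hk]; push_cast; field_simp; ring
    simp only [hE] at e
    push_cast at e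
    linear_combination e / 2
  field_simp
  linear_combination -hrel

theorem inv_shiftedTail_bounds {r t : ℝ} (hr : 0 < r) (ht : r < t) :
    0 < 1 / shiftedTail r t ∧ 1 / shiftedTail r t ≤ 1 / (t ^ 2 - r ^ 2) := by
  have hD : 0 < t ^ 2 - r ^ 2 := by nlinarith
  have h := value_tailCF_pos hr hD
  unfold shiftedTail
  exact ⟨by positivity, one_div_le_one_div_of_le hD (by linarith)⟩

/-! ### Solutions of `δ t + δ (t + c) = 0` -/

/-- The absolute value of `δ` is constant along `t + n * c`, where `δ` tends to zero. -/
theorem eq_zero_of_add_shift_eq_zero {δ : ℝ → ℝ} {c t₀ : ℝ} (hc : 0 < c)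
    (h : ∀ t, t₀ < t → δ t + δ (t + c) = 0) (hlim : Tendsto δ atTop (𝓝 0)) {t : ℝ}
    (ht : t₀ < t) : δ t = 0 := by
  have key : ∀ n : ℕ, |δ (t + n * c)| = |δ t| := by
    intro n
    induction n with
    | zero => simp
    | succ n ih =>
      have h1 := h (t + n * c) (by have : 0 ≤ n * c := by positivity
                                   linarith)
      rw [← ih, eq_neg_of_add_eq_zero_left h1, abs_neg]
      congr 2
      push_cast
      ring
  have h1 : Tendsto (fun n : ℕ => t + n * c) atTop atTop :=
    tendsto_atTop_add_const_left _ _ (tendsto_natCast_atTop_atTop.atTop_mul_const hc)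
  have h2 := (hlim.comp h1).abs
  simp only [Function.comp_def, key, abs_zero] at h2
  exact abs_eq_zero.1 (tendsto_nhds_unique tendsto_const_nhds h2)

/-! ### Laplace transforms of `u ^ n / cosh u` -/

/-- `∫₀^∞ uⁿ e^{-xu} / cosh u du`. -/
def sechLaplace (n : ℕ) (x : ℝ) : ℝ :=
  ∫ u in Set.Ioi (0 : ℝ), u ^ n * Real.exp (-(x * u)) / Real.cosh u

theorem integrableOn_pow_mul_exp (n : ℕ) {x : ℝ} (hx : 0 < x) :
    IntegrableOn (fun u : ℝ => u ^ n * Real.exp (-(x * u))) (Set.Ioi 0) := by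
  have h := integrableOn_rpow_mul_exp_neg_mul_rpow (p := 1) (s := n) (b := x)
    (by have : (0 : ℝ) ≤ n := n.cast_nonneg
        linarith) one_pos hx
  refine h.congr_fun (fun u _ => ?_) measurableSet_Ioi
  simp

theorem integral_pow_mul_exp (n : ℕ) {x : ℝ} (hx : 0 < x) :
    ∫ u in Set.Ioi (0 : ℝ), u ^ n * Real.exp (-(x * u)) = n.factorial / x ^ (n + 1) := by
  have h := Real.integral_rpow_mul_exp_neg_mul_Ioi (a := (n : ℝ) + 1) (by positivity) hx
  simp only [add_sub_cancel_right, Real.rpow_natCast] at h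
  rw [h, Real.Gamma_nat_eq_factorial, one_div, Real.inv_rpow hx.le, ← Nat.cast_add_one,
    Real.rpow_natCast]
  field_simp

theorem continuous_sechLaplace_integrand (n : ℕ) (x : ℝ) :
    Continuous fun u : ℝ => u ^ n * Real.exp (-(x * u)) / Real.cosh u :=
  Continuous.div (by fun_prop) Real.continuous_cosh fun u => (Real.cosh_pos u).ne'

theorem sechLaplace_integrand_le (n : ℕ) (x : ℝ) {u : ℝ} (hu : 0 < u) :
    u ^ n * Real.exp (-(x * u)) / Real.cosh u ≤ u ^ n * Real.exp (-(x * u)) :=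
  div_le_self (by positivity) (Real.one_le_cosh u)

theorem integrableOn_sechLaplace (n : ℕ) {x : ℝ} (hx : 0 < x) :
    IntegrableOn (fun u : ℝ => u ^ n * Real.exp (-(x * u)) / Real.cosh u) (Set.Ioi 0) := by
  refine (integrableOn_pow_mul_exp n hx).mono'
    (continuous_sechLaplace_integrand n x).aestronglyMeasurable ?_
  filter_upwards [ae_restrict_mem measurableSet_Ioi] with u hu
  have hu' : 0 < u := hu
  have := Real.cosh_pos u
  rw [Real.norm_of_nonneg (by positivity)]
  exact sechLaplace_integrand_le n x hu'

theorem sechLaplace_nonneg (n : ℕ) (x : ℝ) : 0 ≤ sechLaplace n x :=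
  setIntegral_nonneg measurableSet_Ioi fun u hu => by
    have hu' : 0 < u := hu
    have := Real.cosh_pos u
    positivity

theorem sechLaplace_le (n : ℕ) {x : ℝ} (hx : 0 < x) :
    sechLaplace n x ≤ n.factorial / x ^ (n + 1) := by
  rw [← integral_pow_mul_exp n hx]
  exact setIntegral_mono_on (integrableOn_sechLaplace n hx) (integrableOn_pow_mul_exp n hx)
    measurableSet_Ioi fun u hu => sechLaplace_integrand_le n x hu

theorem sechLaplace_add (n : ℕ) {x : ℝ} (hx : 0 < x) :
    sechLaplace n x + sechLaplace n (x + 2) = 2 * (n.factorial / (x + 1) ^ (n + 1)) := by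
  unfold sechLaplace
  rw [← integral_add (integrableOn_sechLaplace n hx)
      (integrableOn_sechLaplace n (by linarith : 0 < x + 2)),
    ← integral_pow_mul_exp n (by linarith : 0 < x + 1), ← integral_const_mul]
  congr 1
  funext u
  have hc := (Real.cosh_pos u).ne'
  have e1 : Real.exp (-(x * u)) = Real.exp (-((x + 1) * u)) * Real.exp u := by
    rw [← Real.exp_add]; ring_nf
  have e2 : Real.exp (-((x + 2) * u)) = Real.exp (-((x + 1) * u)) * Real.exp (-u) := by
    rw [← Real.exp_add]; ring_nf
  have e3 : Real.exp u + Real.exp (-u) = 2 * Real.cosh u := by rw [Real.cosh_eq]; ring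
  rw [e1, e2, ← add_div, div_eq_iff hc]
  linear_combination u ^ n * Real.exp (-((x + 1) * u)) * e3

theorem hasDerivAt_sechLaplace (n : ℕ) {x : ℝ} (hx : 0 < x) :
    HasDerivAt (sechLaplace n) (-sechLaplace (n + 1) x) x := by
  have h := (hasDerivAt_integral_of_dominated_loc_of_deriv_le
    (μ := volume.restrict (Set.Ioi (0 : ℝ)))
    (F := fun (x u : ℝ) => u ^ n * Real.exp (-(x * u)) / Real.cosh u)
    (F' := fun (x u : ℝ) => -(u ^ (n + 1) * Real.exp (-(x * u)) / Real.cosh u))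
    -- On the neighbourhood `t > x / 2` the exponential is dominated by its value at `x / 2`.
    (bound := fun u => u ^ (n + 1) * Real.exp (-(x / 2 * u)))
    (Ioi_mem_nhds (half_lt_self hx))
    (Eventually.of_forall fun t => (continuous_sechLaplace_integrand n t).aestronglyMeasurable)
    (integrableOn_sechLaplace n hx)
    (continuous_sechLaplace_integrand (n + 1) x).neg.aestronglyMeasurable ?_
    (integrableOn_pow_mul_exp (n + 1) (half_pos hx)) ?_).2
  · rw [integral_neg] at h
    exact h
  · filter_upwards [ae_restrict_mem measurableSet_Ioi] with u hu t ht
    have hu' : 0 < u := hu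
    have ht' : x / 2 < t := ht
    have := Real.cosh_pos u
    rw [norm_neg, Real.norm_of_nonneg (by positivity)]
    refine (sechLaplace_integrand_le (n + 1) t hu').trans
      (mul_le_mul_of_nonneg_left (Real.exp_le_exp.2 ?_) (by positivity))
    nlinarith
  · refine Eventually.of_forall fun u t _ => ?_
    have h1 : HasDerivAt (fun t : ℝ => -(t * u)) (-u) t := (hasDerivAt_mul_const u).fun_neg
    refine ((h1.exp.const_mul (u ^ n)).div_const (Real.cosh u)).congr_deriv ?_
    ring

/-! ### The two-step continued fraction as an integral -/

theorem inv_shiftedTail_eq {r t : ℝ} (hr : 0 < r) (ht : r < t) :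
    1 / shiftedTail r t = sechLaplace 1 (t / r) / r ^ 2 := by
  have hsq : Tendsto (fun t : ℝ => t ^ 2) atTop atTop := tendsto_pow_atTop two_ne_zero
  refine sub_eq_zero.1 (eq_zero_of_add_shift_eq_zero
    (δ := fun t => 1 / shiftedTail r t - sechLaplace 1 (t / r) / r ^ 2)
    (c := 2 * r) (t₀ := r) (by positivity) (fun t ht => ?_) ?_ ht)
  · have h1 := inv_shiftedTail_add hr ht
    have h2 := sechLaplace_add 1 (x := t / r) (div_pos (hr.trans ht) hr)
    have e1 : (t + 2 * r) / r = t / r + 2 := by field_simp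
    have e2 : t / r + 1 = (t + r) / r := by field_simp
    have h3 : 0 < t + r := by linarith
    rw [e2] at h2
    simp only [e1]
    have h4 : 2 / (t + r) ^ 2 = 2 * (((1 : ℕ).factorial : ℝ) / ((t + r) / r) ^ (1 + 1)) / r ^ 2 := by
      rw [Nat.factorial_one]
      push_cast
      field_simp
    rw [h4, ← h2] at h1
    linear_combination h1
  · rw [← sub_zero (0 : ℝ)]
    refine Tendsto.sub ?_ ?_
    · have hb : Tendsto (fun t : ℝ => 1 / (t ^ 2 - r ^ 2)) atTop (𝓝 0) :=
        tendsto_const_nhds.div_atTop (tendsto_atTop_add_const_right _ (-r ^ 2) hsq)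
      refine tendsto_of_tendsto_of_tendsto_of_le_of_le' tendsto_const_nhds hb ?_ ?_ <;>
      filter_upwards [eventually_gt_atTop r] with t ht
      · exact (inv_shiftedTail_bounds hr ht).1.le
      · exact (inv_shiftedTail_bounds hr ht).2
    · have hb : Tendsto (fun t : ℝ => 1 / t ^ 2) atTop (𝓝 0) := tendsto_const_nhds.div_atTop hsq
      refine tendsto_of_tendsto_of_tendsto_of_le_of_le' tendsto_const_nhds hb
        (Eventually.of_forall fun t => div_nonneg (sechLaplace_nonneg 1 _) (sq_nonneg r)) ?_
      filter_upwards [eventually_gt_atTop 0] with t ht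
      have h1 := sechLaplace_le 1 (x := t / r) (by positivity)
      rw [div_le_iff₀ (by positivity)]
      refine h1.trans (le_of_eq ?_)
      rw [Nat.factorial_one]
      push_cast
      field_simp

/-! ### The logarithm of the generalized Brouncker continued fraction -/

/-- The function `m` is half the integral of `sechLaplace 0`, normalized by a constant: the
derivative of `m x + m (x + 2)` is `1 / (x + 1)`. Since `m` is increasing, the functional equation
squeezes `2 * m x` between `log (x - 1)` and `log (x + 1)`. -/
theorem exists_log_splitting : ∃ m : ℝ → ℝ,
    (∀ x, 0 < x → HasDerivAt m (sechLaplace 0 x / 2) x) ∧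
    (∀ x, 0 < x → m x + m (x + 2) = Real.log (x + 1)) ∧
    Tendsto (fun x => m x - Real.log x / 2) atTop (𝓝 0) := by
  have hcont : ContinuousOn (fun x => sechLaplace 0 x / 2) (Set.Ioi 0) := fun x hx =>
    ((hasDerivAt_sechLaplace 0 hx).continuousAt.div_const 2).continuousWithinAt
  set m₀ : ℝ → ℝ := fun x => ∫ t in (1 : ℝ)..x, sechLaplace 0 t / 2 with hm₀
  have hd₀ : ∀ x, 0 < x → HasDerivAt m₀ (sechLaplace 0 x / 2) x := fun x hx =>
    intervalIntegral.integral_hasDerivAt_right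
      ((hcont.mono fun t ht => lt_of_lt_of_le (lt_min one_pos hx) ht.1).intervalIntegrable)
      (hcont.stronglyMeasurableAtFilter isOpen_Ioi x hx)
      (hcont.continuousAt (Ioi_mem_nhds hx))
  have hshift : ∀ x, 0 < x → HasDerivAt (fun x => m₀ x + m₀ (x + 2) - Real.log (x + 1)) 0 x := by
    intro x hx
    have h1 : HasDerivAt (fun x => m₀ (x + 2)) (sechLaplace 0 (x + 2) / 2) x :=
      (hd₀ (x + 2) (by linarith)).comp_add_const x 2
    have h2 : HasDerivAt (fun x => Real.log (x + 1)) (x + 1)⁻¹ x :=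
      (Real.hasDerivAt_log (by linarith : x + 1 ≠ 0)).comp_add_const x 1
    have h3 := sechLaplace_add 0 hx
    refine (((hd₀ x hx).fun_add h1).fun_sub h2).congr_deriv ?_
    rw [← add_div, h3]
    simp
  have hconst : ∀ x, 0 < x → m₀ x + m₀ (x + 2) - Real.log (x + 1)
      = m₀ 1 + m₀ (1 + 2) - Real.log (1 + 1) := fun x hx =>
    isOpen_Ioi.is_const_of_deriv_eq_zero (convex_Ioi (0 : ℝ)).isPreconnected
      (fun x hx => (hshift x hx).differentiableAt.differentiableWithinAt)
      (fun x hx => (hshift x hx).deriv) hx (Set.mem_Ioi.2 one_pos)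
  set c := m₀ 1 + m₀ (1 + 2) - Real.log (1 + 1)
  have hd : ∀ x, 0 < x → HasDerivAt (fun x => m₀ x - c / 2) (sechLaplace 0 x / 2) x :=
    fun x hx => (hd₀ x hx).sub_const _
  have hadd : ∀ x, 0 < x → (m₀ x - c / 2) + (m₀ (x + 2) - c / 2) = Real.log (x + 1) :=
    fun x hx => by linear_combination hconst x hx
  refine ⟨fun x => m₀ x - c / 2, hd, hadd, ?_⟩
  have hmono : MonotoneOn (fun x => m₀ x - c / 2) (Set.Ioi 0) :=
    monotoneOn_of_deriv_nonneg (convex_Ioi 0)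
      (fun x hx => (hd x hx).continuousAt.continuousWithinAt)
      (fun x hx => (hd x (interior_subset hx)).differentiableAt.differentiableWithinAt)
      (fun x hx => by
        rw [(hd x (interior_subset hx)).deriv]
        exact div_nonneg (sechLaplace_nonneg 0 x) two_pos.le)
  have hlog : ∀ a : ℝ, Tendsto (fun x => (Real.log (x + a) - Real.log x) / 2) atTop (𝓝 0) :=
    fun a => by simpa using (Real.tendsto_log_comp_add_sub_log a).div_const 2
  refine tendsto_of_tendsto_of_tendsto_of_le_of_le' (hlog (-1)) (hlog 1) ?_ ?_
  · filter_upwards [eventually_gt_atTop 2] with x hx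
    have hx2 : 0 < x - 2 := by linarith
    have h1 := hadd (x - 2) hx2
    have h2 : m₀ (x - 2) - c / 2 ≤ m₀ x - c / 2 :=
      hmono hx2 (show (0 : ℝ) < x by linarith) (by linarith)
    rw [sub_add_cancel, show x - 2 + 1 = x + -1 by ring] at h1
    linarith
  · filter_upwards [eventually_gt_atTop 0] with x hx
    have h1 := hadd x hx
    have h2 : m₀ x - c / 2 ≤ m₀ (x + 2) - c / 2 :=
      hmono hx (show (0 : ℝ) < x + 2 by linarith) (by linarith)
    linarith

theorem tendsto_log_y_sub_log {r : ℝ} (hr : 1 / 2 < r) :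
    Tendsto (fun t => Real.log (y t r) - Real.log t) atTop (𝓝 0) := by
  set A := r ^ 2 - (r - 1) ^ 2
  have hb : Tendsto (fun t : ℝ => A / (2 * t ^ 2)) atTop (𝓝 0) :=
    tendsto_const_nhds.div_atTop
      ((tendsto_pow_atTop two_ne_zero).const_mul_atTop (two_pos : (0 : ℝ) < 2))
  refine tendsto_of_tendsto_of_tendsto_of_le_of_le' tendsto_const_nhds hb ?_ ?_ <;>
  filter_upwards [eventually_gt_atTop 0] with t ht
  · exact sub_nonneg.2 (Real.log_le_log ht (y_lower hr ht).le)
  · have hy : 0 < y t r := ht.trans (y_lower hr ht)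
    rw [← Real.log_div hy.ne' ht.ne']
    refine (Real.log_le_sub_one_of_pos (by positivity)).trans ?_
    rw [sub_le_iff_le_add, div_le_iff₀ ht]
    refine (y_upper hr ht).trans (le_of_eq ?_)
    field_simp
    ring

/-- The product in `y_mul_y` factors as `(1 + t) (2r - 1 + t)`. Each factor divided by `r` is `x +
1` for one of the two arguments `x` of `m`, and shifting `t` by `2r` shifts `x` by `2`. The
condition on `t` makes both arguments positive. -/
theorem log_y_eq {m : ℝ → ℝ} (hadd : ∀ x, 0 < x → m x + m (x + 2) = Real.log (x + 1))
    (hlim : Tendsto (fun x => m x - Real.log x / 2) atTop (𝓝 0)) {r t : ℝ} (hr : 1 / 2 < r)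
    (ht : |r - 1| < t) :
    Real.log (y t r) = m ((1 - r + t) / r) + m ((r - 1 + t) / r) + Real.log r := by
  have hr0 : 0 < r := by linarith
  -- Each `m` term behaves like `(log t - log r) / 2`, so the two terms together with `log r` match
  -- `log t`.
  have hscaled : ∀ a : ℝ,
      Tendsto (fun t => m ((a + t) / r) + Real.log r / 2 - Real.log t / 2) atTop (𝓝 0) := by
    intro a
    have h1 : Tendsto (fun t : ℝ => (a + t) / r) atTop atTop :=
      (tendsto_atTop_add_const_left _ a tendsto_id).atTop_div_const hr0
    have h2 := (hlim.comp h1).add ((Real.tendsto_log_comp_add_sub_log a).div_const 2)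
    simp only [zero_div, add_zero] at h2
    refine h2.congr' ?_
    filter_upwards [eventually_gt_atTop (-a)] with t ht
    have h3 : a + t ≠ 0 := by linarith
    rw [Function.comp_apply, Real.log_div h3 hr0.ne', add_comm t a]
    ring
  suffices h : Real.log (y t r) - (m ((1 - r + t) / r) + m ((r - 1 + t) / r) + Real.log r) = 0 from
    sub_eq_zero.1 h
  refine eq_zero_of_add_shift_eq_zero (δ := fun t =>
    Real.log (y t r) - (m ((1 - r + t) / r) + m ((r - 1 + t) / r) + Real.log r))
    (c := 2 * r) (t₀ := |r - 1|) (by positivity) (fun t ht => ?_) ?_ ht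
  · obtain ⟨h1, h2⟩ := abs_lt.1 ht
    have ht0 : 0 < t := (abs_nonneg _).trans_lt ht
    have p1 : 0 < (1 - r + t) / r := div_pos (by linarith) hr0
    have p2 : 0 < (r - 1 + t) / r := div_pos (by linarith) hr0
    have e1 : (1 - r + (t + 2 * r)) / r = (1 - r + t) / r + 2 := by field_simp; ring
    have e2 : (r - 1 + (t + 2 * r)) / r = (r - 1 + t) / r + 2 := by field_simp; ring
    have e3 : (1 - r + t) / r + 1 = (1 + t) / r := by field_simp; ring
    have e4 : (r - 1 + t) / r + 1 = (2 * r - 1 + t) / r := by field_simp; ring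
    have q1 := hadd _ p1
    have q2 := hadd _ p2
    have n1 : 1 + t ≠ 0 := by linarith
    have n2 : 2 * r - 1 + t ≠ 0 := by linarith
    rw [e3, Real.log_div n1 hr0.ne'] at q1
    rw [e4, Real.log_div n2 hr0.ne'] at q2
    have hy := (ht0.trans (y_lower hr ht0)).ne'
    have hy' := (((by linarith : 0 < t + 2 * r)).trans
      (y_lower hr (by linarith : 0 < t + 2 * r))).ne'
    have hl : Real.log (y t r) + Real.log (y (t + 2 * r) r)
        = Real.log (1 + t) + Real.log (2 * r - 1 + t) := by
      rw [← Real.log_mul hy hy', ← Real.log_mul n1 n2, y_mul_y hr ht0]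
      ring_nf
    simp only [e1, e2]
    linear_combination hl - q1 - q2
  · have h := ((tendsto_log_y_sub_log hr).sub (hscaled (1 - r))).sub (hscaled (r - 1))
    simp only [sub_zero] at h
    refine h.congr fun t => ?_
    ring

/-! ### The integral, the denominators and the second derivative of `log y` -/

theorem integrand_eq (s r x : ℝ) : integrand s r x
    = x ^ 1 * Real.exp (-((1 - r + s) / r * x)) / Real.cosh x
      + x ^ 1 * Real.exp (-((r - 1 + s) / r * x)) / Real.cosh x := by
  rw [integrand, neg_mul, neg_mul, pow_one, mul_add, add_div]

theorem integrableOn_integrand {s r : ℝ} (h₁ : 0 < (1 - r + s) / r) (h₂ : 0 < (r - 1 + s) / r) :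
    IntegrableOn (fun x => integrand s r x) (Set.Ioi 0) := by
  simp only [integrand_eq]
  exact (integrableOn_sechLaplace 1 h₁).add (integrableOn_sechLaplace 1 h₂)

theorem integral_integrand {s r : ℝ} (h₁ : 0 < (1 - r + s) / r) (h₂ : 0 < (r - 1 + s) / r) :
    ∫ x in Set.Ioi (0 : ℝ), integrand s r x
      = sechLaplace 1 ((1 - r + s) / r) + sechLaplace 1 ((r - 1 + s) / r) := by
  simp only [integrand_eq]
  exact integral_add (integrableOn_sechLaplace 1 h₁) (integrableOn_sechLaplace 1 h₂)

theorem h₁den_eq (s r : ℝ) : h₁den s r = 2 * shiftedTail r (1 - r + s) := by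
  have e : (1 - r + s) ^ 2 - r ^ 2 = (1 - 2 * r + s) * (1 + s) := by ring
  rw [h₁den, shiftedTail, e]
  ring

theorem h₂den_eq (s r : ℝ) : h₂den s r = 2 * shiftedTail r (r - 1 + s) := by
  have e : (r - 1 + s) ^ 2 - r ^ 2 = (2 * r - 1 + s) * (s - 1) := by ring
  rw [h₂den, shiftedTail, e]
  ring

theorem hasDerivAt_log_y {r t : ℝ} (hr : 1 / 2 < r) (ht : |r - 1| < t) :
    HasDerivAt (fun u => Real.log (y u r))
      ((sechLaplace 0 ((1 - r + t) / r) + sechLaplace 0 ((r - 1 + t) / r)) / (2 * r)) t := by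
  obtain ⟨m, hd, hadd, hlim⟩ := exists_log_splitting
  have hr0 : 0 < r := by linarith
  obtain ⟨h1, h2⟩ := abs_lt.1 ht
  have hlin : ∀ a : ℝ, HasDerivAt (fun u : ℝ => (a + u) / r) (1 / r) t := fun a =>
    ((hasDerivAt_id t).const_add a).div_const r
  have g1 := (hd _ (div_pos (by linarith : 0 < 1 - r + t) hr0)).comp t (hlin (1 - r))
  have g2 := (hd _ (div_pos (by linarith : 0 < r - 1 + t) hr0)).comp t (hlin (r - 1))
  refine (((g1.add g2).add_const (Real.log r)).congr_deriv ?_).congr_of_eventuallyEq ?_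
  · field_simp
  · filter_upwards [Ioi_mem_nhds ht] with u hu
    exact log_y_eq hadd hlim hr hu

theorem hasDerivAt_deriv_log_y {r s : ℝ} (hr : 1 / 2 < r) (hs : |r - 1| < s) :
    HasDerivAt (fun t => deriv (fun u => Real.log (y u r)) t)
      (-(1 / (2 * r ^ 2))
        * (sechLaplace 1 ((1 - r + s) / r) + sechLaplace 1 ((r - 1 + s) / r))) s := by
  have hr0 : 0 < r := by linarith
  obtain ⟨h1, h2⟩ := abs_lt.1 hs
  have hlin : ∀ a : ℝ, HasDerivAt (fun u : ℝ => (a + u) / r) (1 / r) s := fun a =>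
    ((hasDerivAt_id s).const_add a).div_const r
  have g1 := (hasDerivAt_sechLaplace 0 (div_pos (by linarith : 0 < 1 - r + s) hr0)).comp s
    (hlin (1 - r))
  have g2 := (hasDerivAt_sechLaplace 0 (div_pos (by linarith : 0 < r - 1 + s) hr0)).comp s
    (hlin (r - 1))
  refine (((g1.add g2).div_const (2 * r)).congr_deriv ?_).congr_of_eventuallyEq ?_
  · simp only [zero_add]
    field_simp
    ring
  · filter_upwards [Ioi_mem_nhds hs] with t ht
    exact (hasDerivAt_log_y hr ht).deriv

end BrounckerCF

end

theorem theorem12 (s r : ℝ) (hr : 1 / 2 < r) (hs : max 1 (2 * r - 1) < s) :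
    -- the continued fractions involved converge, and all expressions are meaningful
    BrounckerCF.Converges (BrounckerCF.yCF s r) ∧
    0 < BrounckerCF.y s r ∧
    BrounckerCF.Converges (BrounckerCF.tailCF r ((1 - 2 * r + s) * (1 + s))) ∧
    BrounckerCF.Converges (BrounckerCF.tailCF r ((2 * r - 1 + s) * (s - 1))) ∧
    BrounckerCF.h₁den s r ≠ 0 ∧
    BrounckerCF.h₂den s r ≠ 0 ∧
    IntegrableOn (fun x : ℝ => BrounckerCF.integrand s r x) (Set.Ioi 0) ∧
    -- `ln y` is twice differentiable in `s`, with the stated second derivative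
    (∀ᶠ t in 𝓝 s, DifferentiableAt ℝ (fun u : ℝ => Real.log (BrounckerCF.y u r)) t) ∧
    HasDerivAt (fun t : ℝ => deriv (fun u : ℝ => Real.log (BrounckerCF.y u r)) t)
      (-(1 / (2 * r ^ 2)) * ∫ x in Set.Ioi (0 : ℝ), BrounckerCF.integrand s r x) s ∧
    -(1 / (2 * r ^ 2)) * (∫ x in Set.Ioi (0 : ℝ), BrounckerCF.integrand s r x)
      = -BrounckerCF.h₁ s r - BrounckerCF.h₂ s r := by
  obtain ⟨hs1, hs2⟩ := max_lt_iff.1 hs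
  have hr0 : 0 < r := by linarith
  have hs0 : 0 < s := by linarith
  have habs : |r - 1| < s := abs_lt.2 ⟨by linarith, by linarith⟩
  -- The two bounds in `hs` say exactly that `t = 1 - r + s` and `t = r - 1 + s` exceed `r`, which
  -- makes both parameters `D = t² - r²` positive.
  have ht1 : r < 1 - r + s := by linarith
  have ht2 : r < r - 1 + s := by linarith
  have p1 : 0 < (1 - r + s) / r := div_pos (hr0.trans ht1) hr0
  have p2 : 0 < (r - 1 + s) / r := div_pos (hr0.trans ht2) hr0
  have k1 := one_div_pos.1 (BrounckerCF.inv_shiftedTail_bounds hr0 ht1).1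
  have k2 := one_div_pos.1 (BrounckerCF.inv_shiftedTail_bounds hr0 ht2).1
  refine ⟨BrounckerCF.converges_yCF hr hs0, hs0.trans (BrounckerCF.y_lower hr hs0),
    BrounckerCF.converges_tailCF hr0 (mul_pos (by linarith) (by linarith)),
    BrounckerCF.converges_tailCF hr0 (mul_pos (by linarith) (by linarith)),
    ?_, ?_, BrounckerCF.integrableOn_integrand p1 p2, ?_, ?_, ?_⟩
  · rw [BrounckerCF.h₁den_eq]
    positivity
  · rw [BrounckerCF.h₂den_eq]
    positivity
  · filter_upwards [Ioi_mem_nhds habs] with t ht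
    exact (BrounckerCF.hasDerivAt_log_y hr ht).differentiableAt
  · rw [BrounckerCF.integral_integrand p1 p2]
    exact BrounckerCF.hasDerivAt_deriv_log_y hr habs
  · have q1 := BrounckerCF.inv_shiftedTail_eq hr0 ht1
    have q2 := BrounckerCF.inv_shiftedTail_eq hr0 ht2
    rw [BrounckerCF.integral_integrand p1 p2, BrounckerCF.h₁, BrounckerCF.h₂,
      BrounckerCF.h₁den_eq, BrounckerCF.h₂den_eq,
      ← one_div_mul_one_div 2 (BrounckerCF.shiftedTail r (1 - r + s)),
      ← one_div_mul_one_div 2 (BrounckerCF.shiftedTail r (r - 1 + s)), q1, q2]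
    field_simp
    ring
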